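/- For $n\ge 0$ let $L_n$ be the Legendre polynomial of degree $n$ (normalised by $L_n(1)=1$), and for a function $f:[-1,1]\to\mathbb R$ let \[ a_n=\Bigl(n+\tfrac12\Bigr)\int_{-1}^{1}f(x)L_n(x)\,dx,\qquad f_N(x)=\sum_{n=0}^{N}a_nL_n(x). \] Let $\mathbf A=0.825031$, let $r\ge 1$ be an integer, suppose that $f,f',\dots,f^{(r-1)}$ are absolutely continuous on $[-1,1]$ and that the $r$-th derivative $f^{(r)}$ (which exists almost everywhere) is of bounded variation on $[-1,1]$, i.e. agrees almost everywhere with a function of bounded variation. Let \[ U_r=\int_{-1}^{1}|f^{(r+1)}(x)|\,dx, \] where $f^{(r+1)}$ is understood as the measure that is the derivative of $f^{(r)}$; that is, $U_r$ is the total variation of $f^{(r)}$ on $[-1,1]$ (the smallest variation on $[-1,1]$ of a function that agrees with $f^{(r)}$ almost everywhere). Then for every integer $N\ge r+1$ \[ \|f-f_N\|_\infty=\sup_{x\in[-1,1]}|f(x)-f_N(x)|\le \begin{cases} \dfrac{2\mathbf A\,U_1}{\sqrt{N-\frac23}}, & r=1,\\[2ex] \dfrac{\mathbf A\,(N+\frac32)\,U_r}{\Bigl(\prod_{j=1}^{r}(N-r+2j-\frac32)\Bigr)(r-\frac12)\sqrt{N-r+\frac13}},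 & r\ge 3\text{ odd},\\[2ex] \dfrac{\mathbf A\,(N+\frac12)\,U_r}{\Bigl(\prod_{j=1}^{r}(N-r+2j-\frac32)\Bigr)(r-\frac12)\sqrt{N-r+\frac13}}, & r\ge 2\text{ even}. \end{cases} \] -/

import Mathlib

noncomputable section

/-- The Legendre polynomials `L_n`, normalised by `L_n(1) = 1`, through the three-term recurrence
`(n + 2) L_{n+2} = (2 n + 3) X L_{n+1} - (n + 1) L_n`. -/
def legendreL : ℕ → Polynomial ℝ
  | 0 => 1
  | 1 => Polynomial.X
  | n + 2 => Polynomial.C (1 / ((n : ℝ) + 2)) *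
      (Polynomial.C (2 * (n : ℝ) + 3) * Polynomial.X * legendreL (n + 1)
        - Polynomial.C ((n : ℝ) + 1) * legendreL n)

/-- The `n`-th Legendre coefficient `a_n = (n + 1/2) ∫_{-1}^{1} f(x) L_n(x) dx`. -/
def legendreCoeff (f : ℝ → ℝ) (n : ℕ) : ℝ :=
  ((n : ℝ) + 1 / 2) * ∫ x in (-1 : ℝ)..1, f x * (legendreL n).eval x

/-- The partial sum `f_N(x) = ∑_{n=0}^{N} a_n L_n(x)` of the Legendre expansion of `f`. -/
def legendrePartialSum (f : ℝ → ℝ) (N : ℕ) (x : ℝ) : ℝ :=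
  ∑ n ∈ Finset.range (N + 1), legendreCoeff f n * (legendreL n).eval x

/-- The `k`-th derivative of `f` on the interval `[-1, 1]` (one-sided at the end points). -/
def derivOnI (k : ℕ) (f : ℝ → ℝ) : ℝ → ℝ :=
  iteratedDerivWithin k f (Set.Icc (-1) 1)

/-- `g` is a representative of `u` on `[-1, 1]`: they agree almost everywhere there. -/
def IsRepOnI (g u : ℝ → ℝ) : Prop :=
  ∀ᵐ x ∂(MeasureTheory.volume.restrict (Set.Icc (-1 : ℝ) 1)), g x = u x

/-- `u`, given almost everywhere on `[-1, 1]`, is of bounded variation: some representative of it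
has finite pointwise variation on `[-1, 1]`. -/
def HasBVOnI (u : ℝ → ℝ) : Prop :=
  ∃ g : ℝ → ℝ, IsRepOnI g u ∧ BoundedVariationOn g (Set.Icc (-1) 1)

/-- The total variation of `u` on `[-1, 1]`, as an almost everywhere defined function: the least
pointwise variation of a representative. For `u` of bounded variation this is the total mass
`∫_{-1}^{1} |u'(x)| dx` of the derivative measure `u'` on the interval. -/
def essVariationOnI (u : ℝ → ℝ) : ENNReal :=
  ⨅ (g : ℝ → ℝ) (_ : IsRepOnI g u), eVariationOn g (Set.Icc (-1) 1)

/-- `U_r = ∫_{-1}^{1} |f^{(r+1)}(x)| dx`, where `f^{(r+1)}` is the measure that is the derivative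
of the function `f^{(r)}` of bounded variation; that is, the total variation of `f^{(r)}`. -/
def legendreU (r : ℕ) (f : ℝ → ℝ) : ℝ :=
  (essVariationOnI (derivOnI r f)).toReal

/-- The constant `A = 0.825031`. -/
def legendreA : ℝ := 0.825031

end

open Polynomial MeasureTheory


/-! Let `W_m` be the `m`-fold antiderivative of `L_n` vanishing at `±1` for `1 ≤ m ≤ n`
(`legendreAnti n m`). Integrating `∫ f L_n` by parts `r` times leaves `± ∫ f^{(r)} W_r` without
boundary terms, and one more integration by parts against the measure `f^{(r+1)}` gives `|∫ f L_n| ≤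
U_r sup |W_{r+1}|` (`abs_legendreCoeff_le`).

The supremum comes from a second-order equation for `W_{r+1}`: its Sonin function is largest at `0`,
so `W_{r+1}(0)` and `W_r(0)` control everything (`legendreAnti_sq_le`). These two values reduce to
`L_n(0)` and `L_{n-1}(0)`, where `L_k(0)^2 ≤ (2/3)/(k + 2/3)`. This is the source of the constant,
since `√(2/3) < A`.

The resulting bound for `|a_n|` is at most `U_r` times a difference `legendreErr r (n - 1) -
legendreErr r n` (`sqrt_legendreAntiBound_le`), so the sum over `n > N` telescopes to `legendreErr r
N * U_r`. As `|L_n| ≤ 1` on the interval, the series converges uniformly. Completeness identifies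
its limit with `f`, and the tail bounds the error. -/

/-! ### Legendre polynomials: recurrences, differential equation, special values -/

theorem legendreL_add_two (n : ℕ) :
    ((n : ℝ[X]) + 2) * legendreL (n + 2) =
      (2 * (n : ℝ[X]) + 3) * X * legendreL (n + 1) - ((n : ℝ[X]) + 1) * legendreL n := by
  have h : ((n : ℝ[X]) + 2) * C (1 / ((n : ℝ) + 2)) = 1 := by
    have e : ((n : ℝ[X]) + 2) = C ((n : ℝ) + 2) := by simp [map_ofNat]
    rw [e, ← C_mul, mul_one_div_cancel (by positivity), C_1]
  rw [legendreL, ← mul_assoc, h, one_mul]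
  simp [map_ofNat]

/-- The two identities need a joint induction: the differentiated recurrence with the second
identity gives the next first one, and that yields the next second one. -/
theorem derivative_legendreL_aux (n : ℕ) :
    derivative (legendreL (n + 1)) = X * derivative (legendreL n) + ((n : ℝ[X]) + 1) * legendreL n ∧
    X * derivative (legendreL (n + 1)) - derivative (legendreL n) =
      ((n : ℝ[X]) + 1) * legendreL (n + 1) := by
  induction n with
  | zero => simp [legendreL]
  | succ n ih =>
    obtain ⟨ha, hb⟩ := ih
    have hne : ((n : ℝ[X]) + 2) ≠ 0 := by exact_mod_cast (by omega : n + 2 ≠ 0)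
    have hr := legendreL_add_two n
    have hd := congrArg derivative hr
    simp only [derivative_mul, derivative_sub, derivative_add, derivative_natCast,
      derivative_ofNat, derivative_X, derivative_one] at hd
    have h1 : derivative (legendreL (n + 1 + 1)) =
        X * derivative (legendreL (n + 1)) + (((n + 1 : ℕ) : ℝ[X]) + 1) * legendreL (n + 1) := by
      apply mul_left_cancel₀ hne
      push_cast
      linear_combination hd + ((n : ℝ[X]) + 1) * hb
    refine ⟨h1, ?_⟩
    rw [h1]
    push_cast
    linear_combination X * hb - hr - ha

theorem derivative_legendreL_succ (n : ℕ) :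
    derivative (legendreL (n + 1)) =
      X * derivative (legendreL n) + ((n : ℝ[X]) + 1) * legendreL n :=
  (derivative_legendreL_aux n).1

theorem X_mul_derivative_legendreL_succ (n : ℕ) :
    X * derivative (legendreL (n + 1)) - derivative (legendreL n) =
      ((n : ℝ[X]) + 1) * legendreL (n + 1) :=
  (derivative_legendreL_aux n).2

/-- Legendre's differential equation. -/
theorem legendreL_ode (n : ℕ) :
    (1 - X ^ 2) * derivative (derivative (legendreL n)) - 2 * X * derivative (legendreL n) +
      (n : ℝ[X]) * ((n : ℝ[X]) + 1) * legendreL n = 0 := by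
  cases n with
  | zero => simp [legendreL]
  | succ n =>
    have ha := derivative_legendreL_succ n
    have hb := X_mul_derivative_legendreL_succ n
    have h : (1 - X ^ 2) * derivative (legendreL (n + 1)) =
        ((n : ℝ[X]) + 1) * (legendreL n - X * legendreL (n + 1)) := by
      linear_combination ha - X * hb
    have hd := congrArg derivative h
    simp only [derivative_mul, derivative_sub, derivative_add, derivative_natCast,
      derivative_X, derivative_one, derivative_X_pow] at hd
    push_cast at hd ⊢
    simp only [map_ofNat] at hd
    linear_combination hd - ((n : ℝ[X]) + 1) * hb

theorem legendreL_eval_one (n : ℕ) : (legendreL n).eval 1 = 1 := by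
  induction n using Nat.twoStepInduction with
  | zero => simp [legendreL]
  | one => simp [legendreL]
  | more n h0 h1 =>
    have h := congrArg (eval 1) (legendreL_add_two n)
    simp [h0, h1] at h
    have : (n : ℝ) + 2 ≠ 0 := by positivity
    apply mul_left_cancel₀ this
    linarith

theorem legendreL_eval_neg_one (n : ℕ) : (legendreL n).eval (-1) = (-1) ^ n := by
  induction n using Nat.twoStepInduction with
  | zero => simp [legendreL]
  | one => simp [legendreL]
  | more n h0 h1 =>
    have h := congrArg (eval (-1)) (legendreL_add_two n)
    simp [h0, h1] at h
    have : (n : ℝ) + 2 ≠ 0 := by positivity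
    apply mul_left_cancel₀ this
    rw [h]
    ring

theorem legendreL_eval_zero_add_two (n : ℕ) :
    ((n : ℝ) + 2) * (legendreL (n + 2)).eval 0 = -((n + 1) * (legendreL n).eval 0) := by
  have h := congrArg (eval 0) (legendreL_add_two n)
  simpa using h

theorem derivative_legendreL_eval_zero (n : ℕ) :
    (derivative (legendreL (n + 1))).eval 0 = (n + 1) * (legendreL n).eval 0 := by
  have h := congrArg (eval 0) (derivative_legendreL_succ n)
  simpa using h

/-- The value at `0` vanishes for odd degree and is at most `√(2 / (3 n + 2))` for even degree. -/
theorem legendreL_eval_zero_bound (n : ℕ) :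
    (Odd n → (legendreL n).eval 0 = 0) ∧
    (Even n → (legendreL n).eval 0 ^ 2 * (n + 2 / 3) ≤ 2 / 3) := by
  induction n using Nat.twoStepInduction with
  | zero => simp [legendreL]
  | one => simp [legendreL]
  | more n h0 _ =>
    have h := legendreL_eval_zero_add_two n
    have hn : (n : ℝ) + 2 ≠ 0 := by positivity
    have e : (legendreL (n + 2)).eval 0 = -((n + 1) / (n + 2) * (legendreL n).eval 0) := by
      field_simp
      linarith
    rw [e]
    constructor
    · intro ho
      rw [h0.1 (by simpa [Nat.odd_add, parity_simps] using ho)]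
      simp
    · intro he
      refine le_trans ?_ (h0.2 (by simpa [parity_simps] using he))
      have : (-((n + 1) / (n + 2) * (legendreL n).eval 0)) ^ 2 * (((n + 2 : ℕ) : ℝ) + 2 / 3) =
          (legendreL n).eval 0 ^ 2 * ((n + 1) ^ 2 * (n + 2 + 2 / 3) / (n + 2) ^ 2) := by
        push_cast
        field_simp
      rw [this]
      gcongr
      -- What remains is `(n + 1)^2 (n + 8/3) ≤ (n + 2)^2 (n + 2/3)`. With the shift `2/3` the two
      -- sides differ only by `n / 3`.
      rw [div_le_iff₀ (by positivity)]
      nlinarith [(n.cast_nonneg : (0 : ℝ) ≤ n)]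

/-! ### Iterated antiderivatives of Legendre polynomials -/

/-- The `m`-fold antiderivative of `L_n` that vanishes at `±1` to order `m`, for `m ≤ n`. -/
noncomputable def legendreAnti (n : ℕ) : ℕ → ℝ[X]
  | 0 => legendreL n
  -- This is the differential equation of the next antiderivative solved for it, its first
  -- derivative being the current one. At `m = n` the inverse takes the default value `0`, so
  -- nothing is claimed beyond `m = n`.
  | m + 1 => C (-(((n : ℝ) + m + 1) * (n - m))⁻¹) *
      ((1 - X ^ 2) * derivative (legendreAnti n m) + C (2 * (m : ℝ)) * X * legendreAnti n m)

theorem legendreAnti_scale {n m : ℕ} (hm : m < n) (p : ℝ[X]) :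
    C (((n : ℝ) + m + 1) * (n - m)) * (C (-(((n : ℝ) + m + 1) * (n - m))⁻¹) * p) = -p := by
  have h0 : (0 : ℝ) < n - m := by
    rw [sub_pos]; exact_mod_cast hm
  have h1 : ((n : ℝ) + m + 1) * (n - m) ≠ 0 := by positivity
  rw [← mul_assoc, ← C_mul, mul_neg, mul_inv_cancel₀ h1]
  simp

theorem legendreAnti_scale_ne {n m : ℕ} (hm : m < n) :
    C (((n : ℝ) + m + 1) * (n - m)) ≠ 0 := by
  have h0 : (0 : ℝ) < n - m := by
    rw [sub_pos]; exact_mod_cast hm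
  have h1 : ((n : ℝ) + m + 1) * (n - m) ≠ 0 := by positivity
  exact C_ne_zero.2 h1

theorem legendreAnti_succ {n m : ℕ} (hm : m < n) :
    C (((n : ℝ) + m + 1) * (n - m)) * legendreAnti n (m + 1) =
      -((1 - X ^ 2) * derivative (legendreAnti n m) + C (2 * (m : ℝ)) * X * legendreAnti n m) := by
  rw [legendreAnti, legendreAnti_scale hm]

/-- Differentiating the defining formula and subtracting the equation at level `m` shows that the
next polynomial is an antiderivative. Inserting this in the same formula turns it into the equation
at level `m + 1`. -/
theorem legendreAnti_ode_and_derivative (n m : ℕ) (hm : m ≤ n) :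
    ((1 - X ^ 2) * derivative (derivative (legendreAnti n m)) +
      C (2 * ((m : ℝ) - 1)) * X * derivative (legendreAnti n m) +
      C (((n : ℝ) + m) * (n - m + 1)) * legendreAnti n m = 0) ∧
    (m < n → derivative (legendreAnti n (m + 1)) = legendreAnti n m) := by
  have key : ∀ m, m < n → ((1 - X ^ 2) * derivative (derivative (legendreAnti n m)) +
      C (2 * ((m : ℝ) - 1)) * X * derivative (legendreAnti n m) +
      C (((n : ℝ) + m) * (n - m + 1)) * legendreAnti n m = 0) →
      derivative (legendreAnti n (m + 1)) = legendreAnti n m := by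
    intro m hm h
    apply mul_left_cancel₀ (legendreAnti_scale_ne hm)
    have hd := congrArg derivative (legendreAnti_succ hm)
    simp only [derivative_mul, derivative_sub, derivative_add, derivative_neg, derivative_C,
      derivative_X, derivative_one, derivative_X_pow] at hd
    simp only [map_add, map_mul, map_sub, map_natCast, map_one, map_ofNat, Nat.cast_ofNat]
      at hd h ⊢
    linear_combination hd - h
  induction m with
  | zero =>
    have h : (1 - X ^ 2) * derivative (derivative (legendreAnti n 0)) +
      C (2 * (((0 : ℕ) : ℝ) - 1)) * X * derivative (legendreAnti n 0) +
      C (((n : ℝ) + (0 : ℕ)) * (n - (0 : ℕ) + 1)) * legendreAnti n 0 = 0 := by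
      have := legendreL_ode n
      simp only [legendreAnti, map_add, map_mul, map_sub, map_natCast, map_one, map_ofNat,
        Nat.cast_zero, map_zero]
      linear_combination this
    exact ⟨h, fun hn => key 0 hn h⟩
  | succ m ih =>
    obtain ⟨-, h2⟩ := ih (by omega)
    have h2 := h2 hm
    have h : (1 - X ^ 2) * derivative (derivative (legendreAnti n (m + 1))) +
      C (2 * (((m + 1 : ℕ) : ℝ) - 1)) * X * derivative (legendreAnti n (m + 1)) +
      C (((n : ℝ) + (m + 1 : ℕ)) * (n - (m + 1 : ℕ) + 1)) * legendreAnti n (m + 1) = 0 := by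
      have := legendreAnti_succ (n := n) (m := m) hm
      rw [h2]
      simp only [map_add, map_mul, map_sub, map_natCast, map_one, map_ofNat] at this ⊢
      push_cast
      linear_combination this
    exact ⟨h, fun hn => key _ hn h⟩

theorem derivative_legendreAnti_succ {n m : ℕ} (hm : m < n) :
    derivative (legendreAnti n (m + 1)) = legendreAnti n m :=
  (legendreAnti_ode_and_derivative n m hm.le).2 hm

theorem legendreAnti_eval_ode {n m : ℕ} (hm : m ≤ n) (x : ℝ) :
    (1 - x ^ 2) * (derivative (derivative (legendreAnti n m))).eval x +
      2 * ((m : ℝ) - 1) * x * (derivative (legendreAnti n m)).eval x +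
      ((n : ℝ) + m) * (n - m + 1) * (legendreAnti n m).eval x = 0 := by
  have h := congrArg (eval x) (legendreAnti_ode_and_derivative n m hm).1
  simpa using h

theorem legendreAnti_eval_boundary {n m : ℕ} (hm : m < n) {x : ℝ} (hx : x ^ 2 = 1) :
    (legendreAnti n (m + 1)).eval x = 0 := by
  induction m with
  | zero => simp [legendreAnti, hx]
  | succ m ih => rw [legendreAnti]; simp [hx, ih (by omega)]

theorem legendreAnti_eval_zero_succ {n m : ℕ} (hm : m < n) :
    ((n : ℝ) + m + 1) * (n - m) * (legendreAnti n (m + 1)).eval 0 =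
      -(derivative (legendreAnti n m)).eval 0 := by
  have h := congrArg (eval 0) (legendreAnti_succ hm)
  simpa using h

/-! ### Sonin's function and uniform bounds -/

/-- Sonin's function of `legendreAnti n m`. -/
noncomputable def legendreSonin (n m : ℕ) (x : ℝ) : ℝ :=
  ((n : ℝ) + m) * (n - m + 1) * (legendreAnti n m).eval x ^ 2 +
    (1 - x ^ 2) * (derivative (legendreAnti n m)).eval x ^ 2

/-- The differential equation eliminates the second derivative. The sign of `2 m - 1` decides the
behaviour: the function decreases away from `0` for `m ≥ 1` and increases for `m = 0`. -/
theorem hasDerivAt_legendreSonin {n m : ℕ} (hm : m ≤ n) (x : ℝ) :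
    HasDerivAt (legendreSonin n m)
      (-2 * x * (2 * m - 1) * (derivative (legendreAnti n m)).eval x ^ 2) x := by
  have h0 := (legendreAnti n m).hasDerivAt x
  have h1 := (derivative (legendreAnti n m)).hasDerivAt x
  have h := ((h0.pow 2).const_mul (((n : ℝ) + m) * (n - m + 1))).add
    ((((hasDerivAt_id x).pow 2).const_sub 1).mul (h1.pow 2))
  refine h.congr_deriv ?_
  have := legendreAnti_eval_ode hm x
  simp
  linear_combination 2 * (derivative (legendreAnti n m)).eval x * this

theorem continuous_legendreSonin (n m : ℕ) : Continuous (legendreSonin n m) := by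
  unfold legendreSonin
  fun_prop

theorem legendreSonin_le_zero {n m : ℕ} (h1 : 1 ≤ m) (hm : m ≤ n) (x : ℝ) :
    legendreSonin n m x ≤ legendreSonin n m 0 := by
  have hm1 : (1 : ℝ) ≤ m := by exact_mod_cast h1
  rcases le_total 0 x with hx | hx
  · refine antitoneOn_of_deriv_nonpos (convex_Ici 0) (continuous_legendreSonin n m).continuousOn
      (fun y _ => (hasDerivAt_legendreSonin hm y).differentiableAt.differentiableWithinAt)
      (fun y hy => ?_) (Set.mem_Ici.2 le_rfl) (Set.mem_Ici.2 hx) hx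
    rw [interior_Ici, Set.mem_Ioi] at hy
    rw [(hasDerivAt_legendreSonin hm y).deriv]
    have : 0 ≤ 2 * y * (2 * m - 1) * (derivative (legendreAnti n m)).eval y ^ 2 := by
      have : (0 : ℝ) ≤ 2 * m - 1 := by linarith
      positivity
    linarith
  · refine monotoneOn_of_deriv_nonneg (convex_Iic 0) (continuous_legendreSonin n m).continuousOn
      (fun y _ => (hasDerivAt_legendreSonin hm y).differentiableAt.differentiableWithinAt)
      (fun y hy => ?_) (Set.mem_Iic.2 hx) (Set.mem_Iic.2 le_rfl) hx
    rw [interior_Iic, Set.mem_Iio] at hy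
    rw [(hasDerivAt_legendreSonin hm y).deriv]
    have : 0 ≤ 2 * (-y) * (2 * m - 1) * (derivative (legendreAnti n m)).eval y ^ 2 := by
      have : (0 : ℝ) ≤ 2 * m - 1 := by linarith
      have : (0 : ℝ) ≤ -y := by linarith
      positivity
    linarith

/-- For `m = 0` Sonin's function grows with `|x|`, and at `±1` it equals `n (n + 1)`. -/
theorem abs_legendreL_le_one (n : ℕ) {x : ℝ} (hx : x ∈ Set.Icc (-1 : ℝ) 1) :
    |(legendreL n).eval x| ≤ 1 := by
  rcases Nat.eq_zero_or_pos n with rfl | hn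
  · simp [legendreL]
  have hn0 : (0 : ℝ) < n := by exact_mod_cast hn
  have hd := hasDerivAt_legendreSonin (Nat.zero_le n)
  have hS : legendreSonin n 0 x ≤ n * (n + 1) := by
    rcases le_total 0 x with h | h
    · have : legendreSonin n 0 x ≤ legendreSonin n 0 1 := by
        refine monotoneOn_of_deriv_nonneg (convex_Ici 0)
          (continuous_legendreSonin n 0).continuousOn
          (fun y _ => (hd y).differentiableAt.differentiableWithinAt)
          (fun y hy => ?_) (Set.mem_Ici.2 h) (Set.mem_Ici.2 zero_le_one) hx.2
        rw [interior_Ici, Set.mem_Ioi] at hy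
        rw [(hd y).deriv]
        have : 0 ≤ 2 * y * (derivative (legendreAnti n 0)).eval y ^ 2 := by positivity
        push_cast
        linarith
      refine this.trans (le_of_eq ?_)
      simp [legendreSonin, legendreAnti, legendreL_eval_one]
    · have : legendreSonin n 0 x ≤ legendreSonin n 0 (-1) := by
        refine antitoneOn_of_deriv_nonpos (convex_Iic 0)
          (continuous_legendreSonin n 0).continuousOn
          (fun y _ => (hd y).differentiableAt.differentiableWithinAt)
          (fun y hy => ?_) (Set.mem_Iic.2 (by norm_num)) (Set.mem_Iic.2 h) hx.1
        rw [interior_Iic, Set.mem_Iio] at hy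
        rw [(hd y).deriv]
        have : 0 ≤ 2 * (-y) * (derivative (legendreAnti n 0)).eval y ^ 2 := by
          have : (0 : ℝ) ≤ -y := by linarith
          positivity
        push_cast
        linarith
      refine this.trans (le_of_eq ?_)
      simp [legendreSonin, legendreAnti, legendreL_eval_neg_one, ← pow_mul, mul_comm n 2]
  have hx2 : 0 ≤ 1 - x ^ 2 := by nlinarith [hx.1, hx.2]
  have : (n : ℝ) * (n + 1) * (legendreL n).eval x ^ 2 ≤ n * (n + 1) * 1 := by
    have : (0 : ℝ) ≤ (1 - x ^ 2) * (derivative (legendreAnti n 0)).eval x ^ 2 := by positivity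
    simp only [legendreSonin, legendreAnti, Nat.cast_zero, add_zero, sub_zero] at hS this
    linarith
  have := le_of_mul_le_mul_left this (by positivity)
  exact (sq_le_one_iff_abs_le_one _).1 this

/-- The bound for `legendreAnti n (m + 1) ^ 2` on `[-1, 1]` that Sonin's function gives. -/
noncomputable def legendreAntiBound (n m : ℕ) : ℝ :=
  (legendreAnti n (m + 1)).eval 0 ^ 2 +
    (legendreAnti n m).eval 0 ^ 2 / (((n : ℝ) + m + 1) * (n - m))

/-- The derivative in Sonin's function at level `m + 1` is `legendreAnti n m`. Dividing its value at
`0` by the leading coefficient gives the bound. -/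
theorem legendreAnti_sq_le {n m : ℕ} (hm : m < n) {x : ℝ} (hx : x ∈ Set.Icc (-1 : ℝ) 1) :
    (legendreAnti n (m + 1)).eval x ^ 2 ≤ legendreAntiBound n m := by
  have h := legendreSonin_le_zero (Nat.le_add_left 1 m) (Nat.succ_le_of_lt hm) x
  simp only [legendreSonin, derivative_legendreAnti_succ hm] at h
  have hm0 : (0 : ℝ) < n - m := by
    rw [sub_pos]; exact_mod_cast hm
  have hx2 : 0 ≤ (1 - x ^ 2) * (legendreAnti n m).eval x ^ 2 := by
    have : 0 ≤ 1 - x ^ 2 := by nlinarith [hx.1, hx.2]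
    positivity
  have hp : (0 : ℝ) < ((n : ℝ) + m + 1) * (n - m) := by positivity
  rw [legendreAntiBound]
  apply le_of_mul_le_mul_left _ hp
  rw [mul_add, mul_div_cancel₀ _ hp.ne']
  push_cast at h
  nlinarith

/-! ### Estimates for the values at the origin -/

/-- The product `∏_{j=1}^r (x - r + 2 j - 3/2)`. -/
noncomputable def legendreProd (r : ℕ) (x : ℝ) : ℝ :=
  ∏ j ∈ Finset.Icc 1 r, (x - r + 2 * j - 3 / 2)

theorem legendreProd_eq_range (r : ℕ) (x : ℝ) :
    legendreProd r x = ∏ j ∈ Finset.range r, (x - r + 2 * j + 1 / 2) := by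
  rw [legendreProd, Finset.range_eq_Ico, Finset.prod_Ico_eq_prod_range,
    ← Finset.Ico_add_one_right_eq_Icc, Finset.prod_Ico_eq_prod_range]
  refine Finset.prod_congr (by simp) fun j _ => ?_
  push_cast
  ring

theorem legendreProd_zero (x : ℝ) : legendreProd 0 x = 1 := by simp [legendreProd]

theorem legendreProd_one (x : ℝ) : legendreProd 1 x = x - 1 / 2 := by
  simp [legendreProd]; ring

theorem legendreProd_add_two (r : ℕ) (x : ℝ) :
    legendreProd (r + 2) x = (x - r - 3 / 2) * (x + r + 1 / 2) * legendreProd r x := by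
  simp only [legendreProd_eq_range]
  rw [Finset.prod_range_succ, Finset.prod_range_succ']
  have : ∏ k ∈ Finset.range r, (x - ((r + 2 : ℕ) : ℝ) + 2 * ((k + 1 : ℕ) : ℝ) + 1 / 2) =
      ∏ j ∈ Finset.range r, (x - r + 2 * j + 1 / 2) :=
    Finset.prod_congr rfl fun j _ => by push_cast; ring
  rw [this]
  push_cast
  ring

theorem legendreProd_pos {r : ℕ} {x : ℝ} (hx : r ≤ x) : 0 < legendreProd r x := by
  rw [legendreProd_eq_range]
  refine Finset.prod_pos fun j _ => ?_
  have : (0 : ℝ) ≤ j := j.cast_nonneg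
  linarith

theorem legendreAnti_eval_zero_add_two {n m : ℕ} (hm : m + 1 < n) :
    (legendreAnti n (m + 2)).eval 0 =
      -((legendreAnti n m).eval 0 / (((n : ℝ) + m + 2) * (n - m - 1))) := by
  have h := legendreAnti_eval_zero_succ hm
  rw [derivative_legendreAnti_succ (by omega)] at h
  have h1 : (0 : ℝ) < n - m - 1 := by
    have : ((m + 1 : ℕ) : ℝ) < n := by exact_mod_cast hm
    push_cast at this
    linarith
  push_cast at h
  rw [← neg_div, eq_div_iff (by positivity)]
  linarith

/-- Raising the level by two divides both values at `0` by explicit factors, which dominate those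
gained by `legendreProd`. The term `n - r - 5/3` is `n - (r + 2) + 1/3`. -/
theorem legendreAntiBound_add_two {n r : ℕ} (hr : r + 4 ≤ n) :
    legendreAntiBound n (r + 2) * ((n - r - 3 / 2) * (n + r + 1 / 2)) ^ 2 * (n - r - 5 / 3) ≤
      legendreAntiBound n r * (n - r + 1 / 3) := by
  rw [legendreAntiBound, legendreAntiBound, legendreAnti_eval_zero_add_two (by omega),
    legendreAnti_eval_zero_add_two (by omega)]
  generalize (legendreAnti n (r + 1)).eval 0 = y
  generalize (legendreAnti n r).eval 0 = z
  have hs : (4 : ℝ) ≤ n - r := by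
    have : ((r + 4 : ℕ) : ℝ) ≤ n := by exact_mod_cast hr
    push_cast at this
    linarith
  have hu : (0 : ℝ) ≤ n + r := by positivity
  -- In `s = n - r` and `u = n + r` the inequality splits into independent ones: `i1`, `i2` in `s`
  -- alone and `j1`, `j2` in `u` alone.
  obtain ⟨s, hs'⟩ : ∃ s : ℝ, s = n - r := ⟨_, rfl⟩
  obtain ⟨u, hu'⟩ : ∃ u : ℝ, u = n + r := ⟨_, rfl⟩
  push_cast
  have e1 : (n : ℝ) + (r + 1) + 2 = u + 3 := by rw [hu']; ring
  have e2 : (n : ℝ) - (r + 1) - 1 = s - 2 := by rw [hs']; ring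
  have e3 : (n : ℝ) + (r + 2) + 1 = u + 3 := by rw [hu']; ring
  have e4 : (n : ℝ) - (r + 2) = s - 2 := by rw [hs']; ring
  rw [e1, e2, e3, e4, ← hs', ← hu']
  rw [← hs'] at hs
  rw [← hu'] at hu
  clear hs' hu' e1 e2 e3 e4
  have p1 : 0 < s - 2 := by linarith
  have p2 : 0 < s - 1 := by linarith
  have p0 : 0 < s := by linarith
  have i1 : (s - 3 / 2) ^ 2 * (s - 5 / 3) ≤ (s - 2) ^ 2 * (s + 1 / 3) := by nlinarith
  have i2 : (s - 3 / 2) ^ 2 * (s - 5 / 3) * s ≤ (s + 1 / 3) * (s - 1) ^ 2 * (s - 2) := by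
    nlinarith [mul_nonneg (mul_nonneg p0.le p0.le) (sub_nonneg.2 hs), mul_nonneg p0.le (sub_nonneg.2 hs)]
  have j1 : (u + 1 / 2) ^ 2 ≤ (u + 3) ^ 2 := by gcongr; norm_num
  have j2 : (u + 1 / 2) ^ 2 * (u + 1) ≤ (u + 2) ^ 2 * (u + 3) := by gcongr <;> norm_num
  have q0 : 0 ≤ (s - 3 / 2) ^ 2 * (s - 5 / 3) := by
    have : 0 ≤ s - 5 / 3 := by linarith
    positivity
  have k1 := mul_le_mul i1 j1 (by positivity) (by positivity)
  have k2 := mul_le_mul i2 j2 (by positivity) (by positivity)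
  have l1 : (s - 3 / 2) ^ 2 * (s - 5 / 3) * (u + 1 / 2) ^ 2 / ((u + 3) * (s - 2)) ^ 2 ≤
      s + 1 / 3 := by
    rw [div_le_iff₀ (by positivity)]
    linarith
  have l2 : (s - 3 / 2) ^ 2 * (s - 5 / 3) * (u + 1 / 2) ^ 2 /
      (((u + 2) * (s - 1)) ^ 2 * ((u + 3) * (s - 2))) ≤ (s + 1 / 3) / ((u + 1) * s) := by
    rw [div_le_div_iff₀ (by positivity) (by positivity)]
    linarith
  have m1 := mul_le_mul_of_nonneg_left l1 (sq_nonneg y)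
  have m2 := mul_le_mul_of_nonneg_left l2 (sq_nonneg z)
  calc _ = y ^ 2 * ((s - 3 / 2) ^ 2 * (s - 5 / 3) * (u + 1 / 2) ^ 2 / ((u + 3) * (s - 2)) ^ 2) +
        z ^ 2 * ((s - 3 / 2) ^ 2 * (s - 5 / 3) * (u + 1 / 2) ^ 2 /
      (((u + 2) * (s - 1)) ^ 2 * ((u + 3) * (s - 2)))) := by
        field_simp
    _ ≤ _ := add_le_add m1 m2
    _ = _ := by ring

/-- One of the two values vanishes by parity, so the sum costs no more than a single term. -/
theorem legendreL_eval_zero_consecutive (k : ℕ) :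
    (legendreL k).eval 0 ^ 2 * ((k : ℝ) + 2 / 3) +
      (legendreL (k + 1)).eval 0 ^ 2 * ((k : ℝ) + 5 / 3) ≤ 2 / 3 := by
  have h0 := legendreL_eval_zero_bound k
  have h1 := legendreL_eval_zero_bound (k + 1)
  rcases Nat.even_or_odd k with he | ho
  · rw [h1.1 he.add_one]
    simpa using h0.2 he
  · rw [h0.1 ho]
    have := h1.2 ho.add_one
    push_cast at this
    linarith

theorem legendreAnti_one_eval_zero (k : ℕ) :
    (legendreAnti (k + 1) 1).eval 0 = -((legendreL k).eval 0 / (k + 2)) := by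
  have h := legendreAnti_eval_zero_succ (n := k + 1) (m := 0) (by omega)
  simp only [legendreAnti.eq_1, derivative_legendreL_eval_zero, zero_add] at h
  push_cast at h
  have hk : (k : ℝ) + 1 ≠ 0 := by positivity
  have hk2 : (k : ℝ) + 2 ≠ 0 := by positivity
  rw [← neg_div, eq_div_iff hk2]
  apply mul_left_cancel₀ hk
  linarith

theorem legendreAntiBound_zero (k : ℕ) :
    legendreAntiBound (k + 1) 0 = (legendreL k).eval 0 ^ 2 / ((k : ℝ) + 2) ^ 2 +
      (legendreL (k + 1)).eval 0 ^ 2 / (((k : ℝ) + 2) * (k + 1)) := by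
  rw [legendreAntiBound, zero_add, legendreAnti_one_eval_zero, legendreAnti.eq_1]
  push_cast
  rw [neg_sq, div_pow, add_zero, sub_zero]
  ring_nf

theorem legendreAntiBound_one {k : ℕ} (hk : 1 ≤ k) :
    legendreAntiBound (k + 1) 1 = (legendreL k).eval 0 ^ 2 / (((k : ℝ) + 2) ^ 2 * ((k + 3) * k)) +
      (legendreL (k + 1)).eval 0 ^ 2 / (((k : ℝ) + 3) * k) ^ 2 := by
  rw [legendreAntiBound, legendreAnti_eval_zero_add_two (by omega), legendreAnti_one_eval_zero,
    legendreAnti.eq_1]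
  have : (0 : ℝ) < k := by exact_mod_cast hk
  push_cast
  rw [neg_sq, neg_sq, div_pow, div_pow, div_div, add_comm]
  ring_nf

theorem legendreAntiBound_zero_le {n : ℕ} (hn : 2 ≤ n) :
    legendreAntiBound n 0 * (((n : ℝ) + 1 / 2) * (n - 3 / 2)) ^ 2 * (n + 1 / 3) ≤
      2 / 3 * (n + 1 / 2) ^ 2 := by
  obtain ⟨k, rfl⟩ : ∃ k, n = k + 1 := ⟨n - 1, by omega⟩
  have hk : (1 : ℝ) ≤ k := by exact_mod_cast (by omega : 1 ≤ k)
  have h := legendreL_eval_zero_consecutive k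
  rw [legendreAntiBound_zero]
  generalize (legendreL k).eval 0 = a at *
  generalize (legendreL (k + 1)).eval 0 = b at *
  push_cast
  generalize (k : ℝ) = x at *
  have l1 : (x - 1 / 2) ^ 2 * (x + 4 / 3) / (x + 2) ^ 2 ≤ x + 2 / 3 := by
    rw [div_le_iff₀ (by positivity)]
    nlinarith
  have l2 : (x - 1 / 2) ^ 2 * (x + 4 / 3) / ((x + 2) * (x + 1)) ≤ x + 5 / 3 := by
    rw [div_le_iff₀ (by positivity)]
    nlinarith
  have m1 := mul_le_mul_of_nonneg_left l1 (sq_nonneg a)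
  have m2 := mul_le_mul_of_nonneg_left l2 (sq_nonneg b)
  have := mul_le_mul_of_nonneg_right ((add_le_add m1 m2).trans h) (sq_nonneg (x + 1 + 1 / 2))
  refine le_trans (le_of_eq ?_) this
  field_simp
  ring

theorem legendreAntiBound_one_le {n : ℕ} (hn : 3 ≤ n) :
    legendreAntiBound n 1 * ((n : ℝ) - 1 / 2) ^ 2 * ((n + 1 / 2) * (n - 3 / 2)) ^ 2 * (n - 2 / 3) ≤
      2 / 3 * (n + 3 / 2) ^ 2 := by
  obtain ⟨k, rfl⟩ : ∃ k, n = k + 1 := ⟨n - 1, by omega⟩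
  have hk : (2 : ℝ) ≤ k := by exact_mod_cast (by omega : 2 ≤ k)
  have h := legendreL_eval_zero_consecutive k
  rw [legendreAntiBound_one (by omega)]
  generalize (legendreL k).eval 0 = a at *
  generalize (legendreL (k + 1)).eval 0 = b at *
  push_cast
  generalize (k : ℝ) = x at *
  have p1 : 0 < x - 1 / 2 := by linarith
  have p2 : 0 < x := by linarith
  have l1 : (x + 1 / 2) ^ 2 * (x - 1 / 2) ^ 2 * (x + 1 / 3) / ((x + 2) ^ 2 * ((x + 3) * x)) ≤
      x + 2 / 3 := by
    rw [div_le_iff₀ (by positivity)]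
    calc (x + 1 / 2) ^ 2 * (x - 1 / 2) ^ 2 * (x + 1 / 3)
        ≤ (x + 2) ^ 2 * ((x + 3) * x) * (x + 2 / 3) := by
          gcongr
          · norm_num
          · nlinarith
          · norm_num
      _ = _ := by ring
  have l2 : (x + 1 / 2) ^ 2 * (x - 1 / 2) ^ 2 * (x + 1 / 3) / ((x + 3) * x) ^ 2 ≤ x + 5 / 3 := by
    rw [div_le_iff₀ (by positivity)]
    calc (x + 1 / 2) ^ 2 * (x - 1 / 2) ^ 2 * (x + 1 / 3)
        ≤ (x + 3) ^ 2 * x ^ 2 * (x + 5 / 3) := by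
          gcongr
          · norm_num
          · linarith
          · norm_num
      _ = _ := by ring
  have m1 := mul_le_mul_of_nonneg_left l1 (sq_nonneg a)
  have m2 := mul_le_mul_of_nonneg_left l2 (sq_nonneg b)
  have h3 := mul_le_mul ((add_le_add m1 m2).trans h)
    (show (x + 3 / 2) ^ 2 ≤ (x + 1 + 3 / 2) ^ 2 by gcongr; linarith) (by positivity) (by norm_num)
  refine le_trans (le_of_eq ?_) h3
  field_simp
  ring

/-- Sharper form for `r = 1`, whose error bound has a different shape. Here `n - 7/6` is the
midpoint of `n - 5/3` and `n - 2/3`, the radicands of two consecutive error bounds. -/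
theorem legendreAntiBound_one_le_cube {n : ℕ} (hn : 3 ≤ n) :
    legendreAntiBound n 1 * ((n : ℝ) + 1 / 2) ^ 2 * (n - 7 / 6) ^ 3 ≤ 2 / 3 := by
  obtain ⟨k, rfl⟩ : ∃ k, n = k + 1 := ⟨n - 1, by omega⟩
  have hk : (2 : ℝ) ≤ k := by exact_mod_cast (by omega : 2 ≤ k)
  have h := legendreL_eval_zero_consecutive k
  rw [legendreAntiBound_one (by omega)]
  generalize (legendreL k).eval 0 = a at *
  generalize (legendreL (k + 1)).eval 0 = b at *
  push_cast
  generalize (k : ℝ) = x at *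
  have p1 : 0 < x - 1 / 6 := by linarith
  have p2 : 0 < x := by linarith
  have l1 : (x + 3 / 2) ^ 2 * (x - 1 / 6) ^ 3 / ((x + 2) ^ 2 * ((x + 3) * x)) ≤ x + 2 / 3 := by
    rw [div_le_iff₀ (by positivity)]
    calc (x + 3 / 2) ^ 2 * (x - 1 / 6) ^ 3
        = (x + 3 / 2) ^ 2 * ((x - 1 / 6) * (x - 1 / 6)) * (x - 1 / 6) := by ring
      _ ≤ (x + 2) ^ 2 * ((x + 3) * x) * (x + 2 / 3) := by
          gcongr <;> linarith
      _ = _ := by ring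
  have l2 : (x + 3 / 2) ^ 2 * (x - 1 / 6) ^ 3 / ((x + 3) * x) ^ 2 ≤ x + 5 / 3 := by
    rw [div_le_iff₀ (by positivity)]
    calc (x + 3 / 2) ^ 2 * (x - 1 / 6) ^ 3
        = (x + 3 / 2) ^ 2 * (x - 1 / 6) ^ 2 * (x - 1 / 6) := by ring
      _ ≤ (x + 3) ^ 2 * x ^ 2 * (x + 5 / 3) := by
          gcongr <;> linarith
      _ = _ := by ring
  have m1 := mul_le_mul_of_nonneg_left l1 (sq_nonneg a)
  have m2 := mul_le_mul_of_nonneg_left l2 (sq_nonneg b)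
  refine le_trans (le_of_eq ?_) ((add_le_add m1 m2).trans h)
  field_simp
  ring

/-- The shift in the numerator of the error bound. -/
noncomputable def legendreShift (r : ℕ) : ℝ := if Even r then 1 / 2 else 3 / 2

/-- The induction goes by steps of two from `r = 0` and `r = 1`, whence the dependence of the shift
on parity. The factor `n + 1/2` is the normalisation of `a_n`, and `n - 3/2` is what differencing
the error bound contributes. -/
theorem legendreAntiBound_le (r : ℕ) : ∀ n : ℕ, r + 2 ≤ n →
    legendreAntiBound n r * legendreProd r n ^ 2 * (n - r + 1 / 3) *
      ((n + 1 / 2) * (n - 3 / 2)) ^ 2 ≤ 2 / 3 * (n + legendreShift r) ^ 2 := by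
  induction r using Nat.twoStepInduction with
  | zero =>
    intro n hn
    have := legendreAntiBound_zero_le hn
    simp only [legendreProd_zero, legendreShift, Even.zero, if_true, Nat.cast_zero, sub_zero,
      one_pow, mul_one]
    linarith
  | one =>
    intro n hn
    have := legendreAntiBound_one_le hn
    simp only [legendreProd_one, legendreShift, Nat.not_even_one, if_false, Nat.cast_one]
    refine le_trans (le_of_eq ?_) this
    ring
  | more r ih _ =>
    intro n hn
    have h1 := legendreAntiBound_add_two (n := n) (r := r) hn
    have h2 := ih n (by omega)
    have e : legendreShift (r + 2) = legendreShift r := by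
      simp [legendreShift, parity_simps]
    rw [e]
    refine le_trans ?_ h2
    have h3 := mul_le_mul_of_nonneg_right h1
      (mul_nonneg (sq_nonneg (legendreProd r n)) (sq_nonneg (((n : ℝ) + 1 / 2) * (n - 3 / 2))))
    rw [legendreProd_add_two]
    push_cast
    refine le_trans (le_of_eq ?_) (h3.trans (le_of_eq ?_)) <;> ring

theorem legendreShift_pos (r : ℕ) : 0 < legendreShift r := by
  unfold legendreShift; split_ifs <;> norm_num

/-- Apart from positivity, this is all that the argument needs of the constant. -/
theorem two_thirds_le_legendreA_sq : (2 / 3 : ℝ) ≤ legendreA ^ 2 := by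
  norm_num [legendreA]

theorem legendreA_pos : 0 < legendreA := by norm_num [legendreA]

/-! ### Telescoping of the coefficient bounds -/

/-- The error bound per unit of variation, as a function of the degree `x` of the partial sum. -/
noncomputable def legendreErr (r : ℕ) (x : ℝ) : ℝ :=
  if r = 1 then 2 * legendreA / √(x - 2 / 3)
  else legendreA * (x + legendreShift r) / (legendreProd r x * (r - 1 / 2) * √(x - r + 1 / 3))

theorem legendreErr_nonneg {r : ℕ} {x : ℝ} (hr : 1 ≤ r) (hx : r ≤ x) : 0 ≤ legendreErr r x := by
  have := legendreA_pos
  have h1 : (1 : ℝ) ≤ r := by exact_mod_cast hr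
  have h2 : (0 : ℝ) < r - 1 / 2 := by linarith
  have h3 := legendreProd_pos hx
  have h4 := legendreShift_pos r
  have h5 : 0 < x + legendreShift r := by linarith
  unfold legendreErr
  split_ifs <;> positivity

/-- With `y = x - 1/2` the outermost factors pair to `y^2 - a^2`, where `a = r + 1`, and `((y - 1)^2
- a^2) / (y^2 - a^2) ≤ (y - 1)^2 / y^2`. -/
theorem legendreProd_sub_one_mul_le (r : ℕ) : ∀ x : ℝ, r + 1 ≤ x →
    legendreProd r (x - 1) * (x - 1 / 2) ^ r ≤ legendreProd r x * (x - 3 / 2) ^ r := by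
  induction r using Nat.twoStepInduction with
  | zero => simp [legendreProd_zero]
  | one =>
    intro x _
    rw [legendreProd_one, legendreProd_one]
    exact le_of_eq (by ring)
  | more r ih _ =>
    intro x hx
    push_cast at hx
    have hr : (0 : ℝ) ≤ r := r.cast_nonneg
    have h := ih x (by linarith)
    rw [legendreProd_add_two, legendreProd_add_two]
    have hk : (x - 1 - r - 3 / 2) * (x - 1 + r + 1 / 2) * (x - 1 / 2) ^ 2 ≤
        (x - r - 3 / 2) * (x + r + 1 / 2) * (x - 3 / 2) ^ 2 := by
      nlinarith [mul_nonneg (sq_nonneg ((r : ℝ) + 1)) (show (0 : ℝ) ≤ 2 * x - 2 by linarith)]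
    have hp : 0 ≤ legendreProd r (x - 1) := (legendreProd_pos (by linarith)).le
    have h3 : 0 ≤ x - 1 / 2 := by linarith
    have h4 : 0 ≤ (x - r - 3 / 2) * (x + r + 1 / 2) :=
      mul_nonneg (by linarith) (by linarith)
    have := mul_le_mul hk h (by positivity) (by positivity)
    refine le_trans (le_of_eq ?_) (this.trans (le_of_eq ?_)) <;> ring

/-- Put `t = 1 / (x - 3/2)`. From `x - 1` to `x` the product gains `(1 + t)^r ≥ (1 + t)(1 + (r - 1)
t)` by Bernoulli and the root gains `1 + t/2`. One factor `1 + t` pays for the growth of the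
numerator, and the rest is at least `1 + (r - 1/2) t`. -/
theorem legendreErr_step {r : ℕ} (hr : 2 ≤ r) {x : ℝ} (hx : r + 2 ≤ x) :
    legendreErr r x * (1 + (r - 1 / 2) / (x - 3 / 2)) ≤ legendreErr r (x - 1) := by
  have hr2 : (2 : ℝ) ≤ r := by exact_mod_cast hr
  have hA := legendreA_pos
  have hc := legendreShift_pos r
  have hP := legendreProd_pos (r := r) (x := x) (by linarith)
  have hQ := legendreProd_pos (r := r) (x := x - 1) (by linarith)
  have hPQ := legendreProd_sub_one_mul_le r x (by linarith)
  have hx0 : 0 < x - 3 / 2 := by linarith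
  obtain ⟨t, ht⟩ : ∃ t, t = 1 / (x - 3 / 2) := ⟨_, rfl⟩
  have ht0 : 0 < t := by rw [ht]; positivity
  have htx : t * (x - 3 / 2) = 1 := by rw [ht, one_div_mul_cancel hx0.ne']
  have h1 : legendreProd r (x - 1) * ((1 + t) * (1 + (r - 1) * t)) ≤ legendreProd r x := by
    have hb : 1 + ((r - 1 : ℕ) : ℝ) * t ≤ (1 + t) ^ (r - 1) :=
      one_add_mul_le_pow (by linarith) _
    rw [Nat.cast_sub (by omega), Nat.cast_one] at hb
    have hpow : (1 + t) ^ r = (1 + t) * (1 + t) ^ (r - 1) := by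
      rw [← pow_succ', Nat.sub_add_cancel (by omega)]
    have hxt : x - 1 / 2 = (1 + t) * (x - 3 / 2) := by linarith
    rw [hxt, mul_pow, ← mul_assoc] at hPQ
    have := le_of_mul_le_mul_right hPQ (by positivity)
    refine le_trans ?_ this
    rw [hpow]
    gcongr
  have h2 : √(x - 1 - r + 1 / 3) * (1 + t / 2) ≤ √(x - r + 1 / 3) := by
    rw [← Real.sqrt_sq (show (0 : ℝ) ≤ 1 + t / 2 by positivity), ← Real.sqrt_mul' _ (sq_nonneg _)]
    apply Real.sqrt_le_sqrt
    have : (x - 1 - r + 1 / 3) * (t + t ^ 2 / 4) ≤ (x - 3 / 2 - 7 / 6) * (t + t ^ 2 / 4) := by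
      gcongr
      linarith
    have h3 : (x - 3 / 2 - 7 / 6) * (t + t ^ 2 / 4) = 1 + t / 4 - 7 / 6 * (t + t ^ 2 / 4) := by
      linear_combination (1 + t / 4) * htx
    nlinarith [sq_nonneg t]
  have h3 : x + legendreShift r ≤ (x - 1 + legendreShift r) * (1 + t) := by
    nlinarith [mul_nonneg hc.le ht0.le]
  have hS : 0 < √(x - 1 - r + 1 / 3) := Real.sqrt_pos.2 (by linarith)
  have hT : 0 < √(x - r + 1 / 3) := Real.sqrt_pos.2 (by linarith)
  have h4 : 1 + (r - 1 / 2) / (x - 3 / 2) ≤ (1 + (r - 1) * t) * (1 + t / 2) := by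
    have : (r - 1 / 2) / (x - 3 / 2) = (r - 1 / 2) * t := by rw [ht]; ring
    rw [this]
    nlinarith [mul_pos ht0 ht0, mul_nonneg (show (0 : ℝ) ≤ r - 1 by linarith) (mul_pos ht0 ht0).le]
  have hr0 : (0 : ℝ) < r - 1 / 2 := by linarith
  unfold legendreErr
  rw [if_neg (by omega), if_neg (by omega), div_mul_eq_mul_div,
    div_le_div_iff₀ (by positivity) (by positivity)]
  have hr1 : (0 : ℝ) ≤ r - 1 := by linarith
  have hx1 : 0 ≤ x - 1 + legendreShift r := by linarith
  have hx2 : 0 ≤ x + legendreShift r := by linarith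
  calc legendreA * (x + legendreShift r) * (1 + (r - 1 / 2) / (x - 3 / 2)) *
        (legendreProd r (x - 1) * (r - 1 / 2) * √(x - 1 - r + 1 / 3))
      ≤ legendreA * ((x - 1 + legendreShift r) * (1 + t)) * ((1 + (r - 1) * t) * (1 + t / 2)) *
        (legendreProd r (x - 1) * (r - 1 / 2) * √(x - 1 - r + 1 / 3)) := by gcongr
    _ = legendreA * (x - 1 + legendreShift r) *
        ((legendreProd r (x - 1) * ((1 + t) * (1 + (r - 1) * t))) * (r - 1 / 2) *
          (√(x - 1 - r + 1 / 3) * (1 + t / 2))) := by ring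
    _ ≤ _ := by gcongr

theorem legendreAntiBound_nonneg {n r : ℕ} (hr : r < n) : 0 ≤ legendreAntiBound n r := by
  have : (0 : ℝ) < n - r := by
    rw [sub_pos]; exact_mod_cast hr
  unfold legendreAntiBound
  positivity

theorem sqrt_legendreAntiBound_le_of_two_le {n r : ℕ} (hr : 2 ≤ r) (hn : r + 2 ≤ n) :
    (n + 1 / 2) * √(legendreAntiBound n r) ≤ legendreErr r (n - 1) - legendreErr r n := by
  have hr2 : (2 : ℝ) ≤ r := by exact_mod_cast hr
  have hn2 : (r : ℝ) + 2 ≤ n := by exact_mod_cast hn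
  have hA := legendreA_pos
  have hc := legendreShift_pos r
  have hP := legendreProd_pos (r := r) (x := n) (by linarith)
  have hstep := legendreErr_step hr hn2
  have hx0 : (0 : ℝ) < n - 3 / 2 := by linarith
  have hT : 0 < √((n : ℝ) - r + 1 / 3) := Real.sqrt_pos.2 (by linarith)
  have hr0 : (0 : ℝ) < r - 1 / 2 := by linarith
  -- The factor `r - 1/2` now cancels the one in the denominator of `legendreErr`, and squaring
  -- reduces the claim to `legendreAntiBound_le`.
  suffices h : (n + 1 / 2) * √(legendreAntiBound n r) ≤
      legendreErr r n * ((r - 1 / 2) / (n - 3 / 2)) by linarith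
  have e : legendreErr r n * ((r - 1 / 2) / (n - 3 / 2)) =
      legendreA * (n + legendreShift r) /
        (legendreProd r n * √((n : ℝ) - r + 1 / 3) * (n - 3 / 2)) := by
    rw [legendreErr, if_neg (by omega), div_mul_div_comm, div_eq_div_iff (by positivity)
      (by positivity)]
    ring
  have hB := legendreAntiBound_nonneg (n := n) (r := r) (by omega)
  rw [e, le_div_iff₀ (by positivity)]
  have hx2 : (0 : ℝ) ≤ n + legendreShift r := by positivity
  refine abs_le_of_sq_le_sq' ?_ (by positivity) |>.2
  have h := legendreAntiBound_le r n hn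
  have h2 := mul_le_mul_of_nonneg_right two_thirds_le_legendreA_sq
    (sq_nonneg ((n : ℝ) + legendreShift r))
  simp only [mul_pow]
  rw [Real.sq_sqrt hB, Real.sq_sqrt (by linarith)]
  simp only [mul_pow] at h
  linarith

/-- Convexity: the drop of `2 A / √y` over a unit interval is at least its slope `A / c^3` at the
midpoint `c^2`. Since `b^2 - a^2 = 1`, the drop is `2 A / (a b (a + b))`, with `a b ≤ c^2` and `a +
b ≤ 2 c`. -/
theorem sqrt_legendreAntiBound_one_le {n : ℕ} (hn : 3 ≤ n) :
    (n + 1 / 2) * √(legendreAntiBound n 1) ≤ legendreErr 1 (n - 1) - legendreErr 1 n := by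
  have hn3 : (3 : ℝ) ≤ n := by exact_mod_cast hn
  have hA := legendreA_pos
  have h := (legendreAntiBound_one_le_cube hn).trans two_thirds_le_legendreA_sq
  have hB := legendreAntiBound_nonneg (n := n) (r := 1) (by omega)
  generalize (n : ℝ) = x at *
  obtain ⟨a, ha⟩ : ∃ a, a = √(x - 1 - 2 / 3) := ⟨_, rfl⟩
  obtain ⟨b, hb⟩ : ∃ b, b = √(x - 2 / 3) := ⟨_, rfl⟩
  obtain ⟨c, hc⟩ : ∃ c, c = √(x - 7 / 6) := ⟨_, rfl⟩
  have ha0 : 0 < a := by rw [ha]; exact Real.sqrt_pos.2 (by linarith)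
  have hb0 : 0 < b := by rw [hb]; exact Real.sqrt_pos.2 (by linarith)
  have hc0 : 0 < c := by rw [hc]; exact Real.sqrt_pos.2 (by linarith)
  have ha2 : a ^ 2 = x - 1 - 2 / 3 := by rw [ha, Real.sq_sqrt (by linarith)]
  have hb2 : b ^ 2 = x - 2 / 3 := by rw [hb, Real.sq_sqrt (by linarith)]
  have hc2 : c ^ 2 = x - 7 / 6 := by rw [hc, Real.sq_sqrt (by linarith)]
  have hab : a * b ≤ c ^ 2 := by nlinarith [sq_nonneg (a - b)]
  have habs : a + b ≤ 2 * c := by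
    refine abs_le_of_sq_le_sq' ?_ (by positivity) |>.2
    nlinarith [sq_nonneg (a - b)]
  have e1 : legendreErr 1 (x - 1) - legendreErr 1 x = 2 * legendreA / (a * b * (a + b)) := by
    rw [legendreErr, legendreErr, if_pos rfl, if_pos rfl, ← ha, ← hb,
      div_sub_div _ _ ha0.ne' hb0.ne', div_eq_div_iff (by positivity) (by positivity)]
    linear_combination 2 * legendreA * a * b * (hb2 - ha2)
  have h1 : legendreA / c ^ 3 ≤ legendreErr 1 (x - 1) - legendreErr 1 x := by
    rw [e1, div_le_div_iff₀ (by positivity) (by positivity)]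
    calc legendreA * (a * b * (a + b)) ≤ legendreA * (c ^ 2 * (2 * c)) := by gcongr
      _ = _ := by ring
  refine le_trans ?_ h1
  rw [le_div_iff₀ (by positivity)]
  refine abs_le_of_sq_le_sq' ?_ hA.le |>.2
  rw [mul_pow, mul_pow, Real.sq_sqrt hB, ← pow_mul, mul_comm 3 2, pow_mul, hc2]
  linarith

/-- The telescoping estimate. -/
theorem sqrt_legendreAntiBound_le {n r : ℕ} (hr : 1 ≤ r) (hn : r + 2 ≤ n) :
    (n + 1 / 2) * √(legendreAntiBound n r) ≤ legendreErr r (n - 1) - legendreErr r n := by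
  rcases hr.eq_or_lt with rfl | h
  · exact sqrt_legendreAntiBound_one_le hn
  · exact sqrt_legendreAntiBound_le_of_two_le h hn

/-! ### Repeated integration by parts and orthogonality -/

theorem Polynomial.absolutelyContinuousOnInterval (p : ℝ[X]) (a b : ℝ) :
    AbsolutelyContinuousOnInterval (fun x => p.eval x) a b := by
  have h : ContDiff ℝ 1 (fun x => p.eval x) := by simpa using p.contDiff_aeval (𝕜 := ℝ) 1
  exact h.contDiffOn.absolutelyContinuousOnInterval

theorem integral_mul_legendreAnti {u v : ℝ → ℝ} (hu : AbsolutelyContinuousOnInterval u (-1) 1)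
    (huv : ∀ x ∈ Set.Ioo (-1 : ℝ) 1, v x = deriv u x) {n m : ℕ} (hm : m < n) :
    ∫ x in (-1 : ℝ)..1, u x * (legendreAnti n m).eval x =
      -∫ x in (-1 : ℝ)..1, v x * (legendreAnti n (m + 1)).eval x := by
  have h := hu.integral_mul_deriv_eq_deriv_mul
    ((legendreAnti n (m + 1)).absolutelyContinuousOnInterval (-1) 1)
  simp only [Polynomial.deriv, derivative_legendreAnti_succ hm] at h
  rw [h, legendreAnti_eval_boundary hm (by norm_num), legendreAnti_eval_boundary hm (by norm_num)]
  simp only [mul_zero, sub_zero, zero_sub, neg_inj]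
  refine intervalIntegral.integral_congr_ae ?_
  -- The integral runs over `(-1, 1]`, so only the endpoint `1`, a null set, escapes `huv`.
  filter_upwards [compl_mem_ae_iff.2 (measure_singleton (1 : ℝ))] with x hx1 hx
  rw [Set.uIoc_of_le (by norm_num)] at hx
  rw [huv x ⟨hx.1, lt_of_le_of_ne hx.2 hx1⟩]

theorem integral_mul_legendreL_eq {F : ℕ → ℝ → ℝ} {r n : ℕ} (hr : r ≤ n)
    (hac : ∀ k < r, AbsolutelyContinuousOnInterval (F k) (-1) 1)
    (hF : ∀ k < r, ∀ x ∈ Set.Ioo (-1 : ℝ) 1, F (k + 1) x = deriv (F k) x) :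
    ∫ x in (-1 : ℝ)..1, F 0 x * (legendreL n).eval x =
      (-1) ^ r * ∫ x in (-1 : ℝ)..1, F r x * (legendreAnti n r).eval x := by
  induction r with
  | zero => simp [legendreAnti]
  | succ r ih =>
    rw [ih (by omega) (fun k hk => hac k (by omega)) (fun k hk => hF k (by omega)),
      integral_mul_legendreAnti (hac r (by omega)) (hF r (by omega)) (by omega)]
    ring

/-- After `n` integrations by parts the `n`-th derivative of `p` appears, which is zero. -/
theorem integral_mul_legendreL_of_natDegree_lt {p : ℝ[X]} {n : ℕ} (hp : p.natDegree < n) :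
    ∫ x in (-1 : ℝ)..1, p.eval x * (legendreL n).eval x = 0 := by
  have h := integral_mul_legendreL_eq (F := fun k x => (derivative^[k] p).eval x) (le_refl n)
    (fun k _ => Polynomial.absolutelyContinuousOnInterval _ _ _)
    (fun k _ x _ => by simp only [Function.iterate_succ_apply', Polynomial.deriv])
  simpa [iterate_derivative_eq_zero hp] using h

theorem natDegree_legendreL_le (n : ℕ) : (legendreL n).natDegree ≤ n := by
  induction n using Nat.twoStepInduction with
  | zero => simp [legendreL]
  | one => simp [legendreL]
  | more n h0 h1 =>
    rw [legendreL]
    refine (natDegree_C_mul_le _ _).trans ((natDegree_sub_le _ _).trans (max_le ?_ ?_))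
    · rw [mul_assoc]
      refine (natDegree_C_mul_le _ _).trans (natDegree_mul_le.trans ?_)
      have := natDegree_X_le (R := ℝ)
      omega
    · exact (natDegree_C_mul_le _ _).trans (by omega)

theorem integral_legendreL_mul_of_ne {m n : ℕ} (h : m ≠ n) :
    ∫ x in (-1 : ℝ)..1, (legendreL m).eval x * (legendreL n).eval x = 0 := by
  rcases h.lt_or_gt with h | h
  · exact integral_mul_legendreL_of_natDegree_lt ((natDegree_legendreL_le m).trans_lt h)
  · simp_rw [mul_comm (eval _ (legendreL m))]
    exact integral_mul_legendreL_of_natDegree_lt ((natDegree_legendreL_le n).trans_lt h)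

/-- For `p = L_{n+1}`, `(x p^2)'` has integral `2`. Since `x p' = L_n' + (n + 1) p`, it equals `(2 n
+ 3) p^2 + 2 L_n' p`, and the last term integrates to zero by degree. -/
theorem integral_legendreL_mul_self (n : ℕ) :
    ((n : ℝ) + 1 / 2) * ∫ x in (-1 : ℝ)..1, (legendreL n).eval x * (legendreL n).eval x = 1 := by
  cases n with
  | zero => norm_num [legendreL]
  | succ n =>
    obtain ⟨p, hp⟩ : ∃ p, p = legendreL (n + 1) := ⟨_, rfl⟩
    have hint : ∀ q : ℝ[X], IntervalIntegrable (fun x => q.eval x) volume (-1) 1 :=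
      fun q => q.continuous.intervalIntegrable _ _
    have h1 : ∫ x in (-1 : ℝ)..1, (derivative (X * p ^ 2)).eval x = 2 := by
      rw [intervalIntegral.integral_eq_sub_of_hasDerivAt
        (fun x _ => (X * p ^ 2).hasDerivAt x) (hint _)]
      simp only [hp, eval_mul, eval_X, eval_pow, legendreL_eval_one, legendreL_eval_neg_one,
        ← pow_mul, mul_comm (n + 1) 2]
      simp
      norm_num
    have h2 : ∫ x in (-1 : ℝ)..1, (derivative (legendreL n)).eval x * p.eval x = 0 := by
      rw [hp]
      apply integral_mul_legendreL_of_natDegree_lt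
      have := natDegree_derivative_le (legendreL n)
      have := natDegree_legendreL_le n
      omega
    have h3 : (2 * ((n : ℝ) + 1) + 1) * ∫ x in (-1 : ℝ)..1, p.eval x * p.eval x =
        (∫ x in (-1 : ℝ)..1, (derivative (X * p ^ 2)).eval x) -
          2 * ∫ x in (-1 : ℝ)..1, (derivative (legendreL n)).eval x * p.eval x := by
      rw [← intervalIntegral.integral_const_mul, ← intervalIntegral.integral_const_mul,
        ← intervalIntegral.integral_sub (hint _)]
      · refine intervalIntegral.integral_congr fun x _ => ?_
        have h := congrArg (eval x) (X_mul_derivative_legendreL_succ n)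
        rw [← hp] at h
        simp [derivative_pow] at h ⊢
        linear_combination -2 * eval x p * h
      · exact Continuous.intervalIntegrable (by fun_prop) _ _
    rw [h1, h2] at h3
    rw [← hp]
    push_cast
    linarith

/-! ### Integration by parts against a function of bounded variation -/

/-- On a short interval `g` is replaced by its left value: what remains is a jump term `p(y) (g(y) -
g(x))` and an error proportional to the length. -/
theorem abs_integral_mul_derivative_sub_le {g v : ℝ → ℝ} {s : Set ℝ} (p : ℝ[X]) {M C x y : ℝ}
    (hxy : x ≤ y) (hs : Set.Icc x y ⊆ s) (hg : IntervalIntegrable g volume x y)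
    (hv : MonotoneOn v s) (hgv : ∀ a ∈ s, ∀ b ∈ s, a ≤ b → |g b - g a| ≤ v b - v a)
    (hM : ∀ a ∈ s, |p.eval a| ≤ M) (hC : ∀ a ∈ s, |(derivative p).eval a| ≤ C) :
    |(∫ t in x..y, g t * (derivative p).eval t) - (g y * p.eval y - g x * p.eval x)| ≤
      (M + C * (y - x)) * (v y - v x) := by
  have hx : x ∈ s := hs ⟨le_rfl, hxy⟩
  have hy : y ∈ s := hs ⟨hxy, le_rfl⟩
  have hp : ContinuousOn (fun t => (derivative p).eval t) (Set.uIcc x y) :=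
    (derivative p).continuous.continuousOn
  have h0 : ∫ t in x..y, (derivative p).eval t = p.eval y - p.eval x :=
    intervalIntegral.integral_eq_sub_of_hasDerivAt (fun t _ => p.hasDerivAt t)
      ((derivative p).continuous.intervalIntegrable _ _)
  have h1 : (∫ t in x..y, (g t - g x) * (derivative p).eval t) =
      (∫ t in x..y, g t * (derivative p).eval t) - g x * (p.eval y - p.eval x) := by
    rw [← h0, ← intervalIntegral.integral_const_mul, ← intervalIntegral.integral_sub]
    · simp_rw [sub_mul]
    · exact hg.mul_continuousOn hp
    · exact ((derivative p).continuous.intervalIntegrable _ _).const_mul _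
  have h2 : |∫ t in x..y, (g t - g x) * (derivative p).eval t| ≤ (v y - v x) * C * |y - x| := by
    refine intervalIntegral.norm_integral_le_of_norm_le_const (E := ℝ) fun t ht => ?_
    rw [Set.uIoc_of_le hxy] at ht
    have hts : t ∈ s := hs ⟨ht.1.le, ht.2⟩
    rw [Real.norm_eq_abs, abs_mul]
    have ha := hgv x hx t hts ht.1.le
    have hb := hv hts hy ht.2
    exact mul_le_mul (by linarith) (hC t hts) (abs_nonneg _)
      (sub_nonneg.2 (hv hx hy hxy))
  have h3 : |p.eval y * (g y - g x)| ≤ M * (v y - v x) := by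
    rw [abs_mul]
    exact mul_le_mul (hM y hy) (hgv x hx y hy hxy) (abs_nonneg _)
      ((abs_nonneg _).trans (hM y hy))
  have e : (∫ t in x..y, g t * (derivative p).eval t) - (g y * p.eval y - g x * p.eval x) =
      (∫ t in x..y, (g t - g x) * (derivative p).eval t) - p.eval y * (g y - g x) := by
    rw [h1]; ring
  rw [e]
  rw [abs_of_nonneg (sub_nonneg.2 hxy)] at h2
  refine (abs_sub _ _).trans ?_
  linarith

/-- Summed over a uniform partition, the boundary terms telescope to zero and the increments of `v`
to `v b - v a`. The term with `C` disappears as the mesh tends to zero, so no continuity of `g` is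
needed. -/
theorem abs_integral_mul_derivative_le {g v : ℝ → ℝ} {a b : ℝ} (p : ℝ[X]) {M : ℝ}
    (hab : a ≤ b) (hg : IntervalIntegrable g volume a b)
    (hv : MonotoneOn v (Set.Icc a b))
    (hgv : ∀ x ∈ Set.Icc a b, ∀ y ∈ Set.Icc a b, x ≤ y → |g y - g x| ≤ v y - v x)
    (hM : ∀ x ∈ Set.Icc a b, |p.eval x| ≤ M) (hpa : p.eval a = 0) (hpb : p.eval b = 0) :
    |∫ t in a..b, g t * (derivative p).eval t| ≤ M * (v b - v a) := by
  obtain ⟨C, hC⟩ := isCompact_Icc.exists_bound_of_continuousOn (s := Set.Icc a b)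
    (derivative p).continuous.continuousOn
  have key : ∀ n : ℕ, |∫ t in a..b, g t * (derivative p).eval t| ≤
      (M + C * ((b - a) / ((n : ℝ) + 1))) * (v b - v a) := by
    intro n
    obtain ⟨h, hh⟩ : ∃ h : ℝ, h = (b - a) / ((n : ℝ) + 1) := ⟨_, rfl⟩
    have hh0 : 0 ≤ h := by
      rw [hh]; exact div_nonneg (sub_nonneg.2 hab) (by positivity)
    obtain ⟨t, ht⟩ : ∃ t : ℕ → ℝ, t = fun i : ℕ => a + i * h := ⟨_, rfl⟩
    have t0 : t 0 = a := by simp [ht]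
    have tn : t (n + 1) = b := by
      simp only [ht, hh]; push_cast; field_simp; ring
    have hmono : Monotone t := by
      intro i j hij
      simp only [ht]
      gcongr
    have hmem : ∀ i ≤ n + 1, t i ∈ Set.Icc a b := fun i hi =>
      ⟨t0 ▸ hmono (Nat.zero_le i), tn ▸ hmono hi⟩
    have hsub : ∀ i < n + 1, Set.Icc (t i) (t (i + 1)) ⊆ Set.Icc a b := fun i hi =>
      Set.Icc_subset_Icc (hmem i hi.le).1 (hmem (i + 1) hi).2
    have hgi : ∀ i < n + 1, IntervalIntegrable g volume (t i) (t (i + 1)) := fun i hi =>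
      hg.mono_set (by
        rw [Set.uIcc_of_le (hmono (Nat.le_succ i)), Set.uIcc_of_le hab]; exact hsub i hi)
    have hstep : ∀ i ∈ Finset.range (n + 1),
        |(∫ x in t i..t (i + 1), g x * (derivative p).eval x) -
          (g (t (i + 1)) * p.eval (t (i + 1)) - g (t i) * p.eval (t i))| ≤
        (M + C * h) * (v (t (i + 1)) - v (t i)) := by
      intro i hi
      have hi := Finset.mem_range.1 hi
      have := abs_integral_mul_derivative_sub_le p (hmono (Nat.le_succ i)) (hsub i hi) (hgi i hi)
        hv hgv hM hC
      have e : t (i + 1) - t i = h := by simp only [ht]; push_cast; ring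
      rwa [e] at this
    have hsum := (Finset.abs_sum_le_sum_abs _ _).trans (Finset.sum_le_sum hstep)
    rw [Finset.sum_sub_distrib, ← Finset.mul_sum, Finset.sum_range_sub (fun i => v (t i)),
      Finset.sum_range_sub (fun i => g (t i) * p.eval (t i)),
      intervalIntegral.sum_integral_adjacent_intervals (fun i hi =>
        (hgi i hi).mul_continuousOn (derivative p).continuous.continuousOn), t0, tn, hpa, hpb] at hsum
    simpa [hh] using hsum
  have hlim : Filter.Tendsto (fun n : ℕ => (M + C * ((b - a) / ((n : ℝ) + 1))) * (v b - v a))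
      Filter.atTop (nhds ((M + C * 0) * (v b - v a))) := by
    have h1 : Filter.Tendsto (fun n : ℕ => (b - a) / ((n : ℝ) + 1)) Filter.atTop (nhds 0) := by
      have := (tendsto_one_div_add_atTop_nhds_zero_nat (𝕜 := ℝ)).const_mul (b - a)
      simpa only [mul_one_div, mul_zero] using this
    exact ((h1.const_mul C).const_add M).mul_const _
  simpa using ge_of_tendsto' hlim key

theorem BoundedVariationOn.intervalIntegrable {g : ℝ → ℝ} {a b : ℝ} (hab : a ≤ b)
    (hg : BoundedVariationOn g (Set.Icc a b)) : IntervalIntegrable g volume a b := by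
  obtain ⟨p, q, hp, hq, rfl⟩ := hg.locallyBoundedVariationOn.exists_monotoneOn_sub_monotoneOn
  rw [← Set.uIcc_of_le hab] at hp hq
  exact hp.intervalIntegrable.sub hq.intervalIntegrable

/-- Integration against the derivative of a polynomial vanishing at the end points is bounded by
the total variation. -/
theorem BoundedVariationOn.abs_integral_mul_derivative_le {g : ℝ → ℝ} {a b : ℝ} (hab : a ≤ b)
    (hg : BoundedVariationOn g (Set.Icc a b)) (p : ℝ[X]) {M : ℝ}
    (hM : ∀ x ∈ Set.Icc a b, |p.eval x| ≤ M) (hpa : p.eval a = 0) (hpb : p.eval b = 0) :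
    |∫ t in a..b, g t * (derivative p).eval t| ≤
      M * (eVariationOn g (Set.Icc a b)).toReal := by
  have hl := hg.locallyBoundedVariationOn
  have ha : a ∈ Set.Icc a b := ⟨le_rfl, hab⟩
  have h := _root_.abs_integral_mul_derivative_le (v := variationOnFromTo g (Set.Icc a b) a) p hab
    (hg.intervalIntegrable hab) (variationOnFromTo.monotoneOn hl ha)
    (fun x hx y hy hxy => variationOnFromTo.abs_sub_le_sub_of_le hl ha hx hy hxy) hM hpa hpb
  rwa [variationOnFromTo.self, sub_zero, variationOnFromTo.eq_of_le _ _ hab, Set.inter_self] at h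

/-! ### Bounds for the Legendre coefficients -/

theorem derivOnI_zero (f : ℝ → ℝ) : derivOnI 0 f = f := iteratedDerivWithin_zero

theorem derivOnI_succ_eq_deriv (k : ℕ) (f : ℝ → ℝ) {x : ℝ} (hx : x ∈ Set.Ioo (-1 : ℝ) 1) :
    derivOnI (k + 1) f x = deriv (derivOnI k f) x := by
  rw [derivOnI, iteratedDerivWithin_succ]
  exact derivWithin_of_mem_nhds (Icc_mem_nhds hx.1 hx.2)

theorem legendreU_nonneg (r : ℕ) (f : ℝ → ℝ) : 0 ≤ legendreU r f := ENNReal.toReal_nonneg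

theorem essVariationOnI_ne_top {u : ℝ → ℝ} (h : HasBVOnI u) : essVariationOnI u ≠ ⊤ := by
  obtain ⟨g, hg, hbv⟩ := h
  exact ne_top_of_le_ne_top hbv (iInf₂_le g hg)

theorem abs_legendreCoeff_le_of_isRepOnI {r n : ℕ} (hr : r < n) {f g : ℝ → ℝ}
    (hac : ∀ k < r, AbsolutelyContinuousOnInterval (derivOnI k f) (-1) 1)
    (hg : IsRepOnI g (derivOnI r f)) (hbv : BoundedVariationOn g (Set.Icc (-1) 1)) :
    |legendreCoeff f n| ≤
      (n + 1 / 2) * √(legendreAntiBound n r) * (eVariationOn g (Set.Icc (-1) 1)).toReal := by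
  have h := integral_mul_legendreL_eq (F := fun k => derivOnI k f) hr.le hac
    (fun k _ x hx => derivOnI_succ_eq_deriv k f hx)
  have hrep : ∫ x in (-1 : ℝ)..1, derivOnI r f x * (legendreAnti n r).eval x =
      ∫ x in (-1 : ℝ)..1, g x * (derivative (legendreAnti n (r + 1))).eval x := by
    rw [derivative_legendreAnti_succ hr]
    refine intervalIntegral.integral_congr_ae ?_
    have hg' := (ae_restrict_iff' measurableSet_Icc).1 hg
    filter_upwards [hg'] with x hx hx1
    rw [Set.uIoc_of_le (by norm_num)] at hx1
    rw [hx ⟨hx1.1.le, hx1.2⟩]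
  have hb := hbv.abs_integral_mul_derivative_le (by norm_num) (legendreAnti n (r + 1))
    (fun x hx => Real.abs_le_sqrt (legendreAnti_sq_le hr hx))
    (legendreAnti_eval_boundary hr (by norm_num)) (legendreAnti_eval_boundary hr (by norm_num))
  simp only [derivOnI_zero] at h
  rw [legendreCoeff, h, hrep, abs_mul, abs_mul, abs_pow, abs_neg, abs_one, one_pow, one_mul,
    abs_of_nonneg (by positivity), mul_assoc]
  gcongr

/-- Representatives with variation within `ε` of the infimum suffice, so the infimum need not be
attained. -/
theorem abs_legendreCoeff_le {r n : ℕ} (hr : r < n) {f : ℝ → ℝ}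
    (hac : ∀ k < r, AbsolutelyContinuousOnInterval (derivOnI k f) (-1) 1)
    (hbv : HasBVOnI (derivOnI r f)) :
    |legendreCoeff f n| ≤ (n + 1 / 2) * √(legendreAntiBound n r) * legendreU r f := by
  have hfin := essVariationOnI_ne_top hbv
  obtain ⟨c, hc⟩ : ∃ c, c = (n + 1 / 2) * √(legendreAntiBound n r) := ⟨_, rfl⟩
  have hc0 : 0 ≤ c := by rw [hc]; positivity
  have key : ∀ ε : ℝ, 0 < ε → |legendreCoeff f n| ≤ c * (legendreU r f + ε) := by
    intro ε hε
    have hlt : essVariationOnI (derivOnI r f) < essVariationOnI (derivOnI r f) + ENNReal.ofReal ε :=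
      ENNReal.lt_add_right hfin (by simpa using hε)
    have hlt' := hlt
    conv_lhs at hlt' => rw [essVariationOnI]
    simp only [iInf_lt_iff] at hlt'
    obtain ⟨g, hg, hlt'⟩ := hlt'
    have hsum : essVariationOnI (derivOnI r f) + ENNReal.ofReal ε ≠ ⊤ :=
      ENNReal.add_ne_top.2 ⟨hfin, ENNReal.ofReal_ne_top⟩
    have h := abs_legendreCoeff_le_of_isRepOnI hr hac hg (ne_top_of_lt hlt')
    have h2 := ENNReal.toReal_mono hsum hlt'.le
    rw [ENNReal.toReal_add hfin ENNReal.ofReal_ne_top, ENNReal.toReal_ofReal hε.le] at h2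
    rw [← hc] at h
    exact h.trans (mul_le_mul_of_nonneg_left h2 hc0)
  rw [← hc]
  refine le_of_forall_pos_le_add fun ε hε => ?_
  -- Dividing by `c + 1` avoids a case distinction on `c = 0`.
  refine (key (ε / (c + 1)) (by positivity)).trans ?_
  rw [mul_add]
  gcongr
  rw [mul_div_assoc', div_le_iff₀ (by positivity)]
  nlinarith

/-! ### Completeness and pointwise convergence -/

/-- The three-term recurrence writes `x L_{k+1}` through `L_{k+2}` and `L_k`, so orthogonality
passes to all `x^j L_k` by induction on `j`. The case `k = 0` gives the monomials. -/
theorem integral_mul_polynomial_eq_zero {h : ℝ → ℝ} (hc : ContinuousOn h (Set.Icc (-1) 1))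
    (hL : ∀ k, ∫ x in (-1 : ℝ)..1, h x * (legendreL k).eval x = 0) (p : ℝ[X]) :
    ∫ x in (-1 : ℝ)..1, h x * p.eval x = 0 := by
  have hint : ∀ q : ℝ[X], IntervalIntegrable (fun x => h x * q.eval x) volume (-1) 1 := fun q =>
    (hc.mul q.continuous.continuousOn).intervalIntegrable_of_Icc (by norm_num)
  have hX : ∀ j k : ℕ, ∫ x in (-1 : ℝ)..1, h x * (X ^ j * legendreL k).eval x = 0 := by
    intro j
    induction j with
    | zero => simpa using hL
    | succ j ih =>
      intro k
      cases k with
      | zero =>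
        have := ih 1
        simpa [legendreL, pow_succ] using this
      | succ k =>
        have e : ∀ x, h x * (X ^ (j + 1) * legendreL (k + 1)).eval x =
            (((k : ℝ) + 2) / (2 * k + 3)) * (h x * (X ^ j * legendreL (k + 2)).eval x) +
            (((k : ℝ) + 1) / (2 * k + 3)) * (h x * (X ^ j * legendreL k).eval x) := by
          intro x
          have hr := congrArg (eval x) (legendreL_add_two k)
          simp only [eval_mul, eval_add, eval_sub, eval_natCast, eval_ofNat, eval_X, eval_one] at hr
          simp only [eval_mul, eval_pow, eval_X]
          field_simp
          linear_combination (-h x * x ^ j) * hr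
        simp_rw [e]
        rw [intervalIntegral.integral_add ((hint _).const_mul _) ((hint _).const_mul _),
          intervalIntegral.integral_const_mul, intervalIntegral.integral_const_mul, ih, ih]
        simp
  induction p using Polynomial.induction_on' with
  | add p q hp hq =>
    simp_rw [eval_add, mul_add]
    rw [intervalIntegral.integral_add (hint p) (hint q), hp, hq, add_zero]
  | monomial n a =>
    have := hX n 0
    simp only [legendreL, mul_one, eval_pow, eval_X] at this
    simp_rw [eval_monomial, mul_left_comm _ a]
    rw [intervalIntegral.integral_const_mul, this, mul_zero]

/-- The Legendre polynomials are complete in the continuous functions on `[-1, 1]`. -/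
theorem eq_zero_of_integral_mul_legendreL_eq_zero {h : ℝ → ℝ}
    (hc : ContinuousOn h (Set.Icc (-1) 1))
    (hL : ∀ k, ∫ x in (-1 : ℝ)..1, h x * (legendreL k).eval x = 0) :
    ∀ x ∈ Set.Icc (-1 : ℝ) 1, h x = 0 := by
  obtain ⟨C, hC⟩ := isCompact_Icc.exists_bound_of_continuousOn hc
  have hC0 : 0 ≤ C := (norm_nonneg _).trans (hC 0 (by norm_num))
  have hsq : ∀ ε > 0, ∫ x in (-1 : ℝ)..1, h x * h x ≤ C * ε * 2 := by
    intro ε hε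
    obtain ⟨p, hp⟩ := exists_polynomial_near_of_continuousOn (-1) 1 h hc ε hε
    have hi : IntervalIntegrable (fun x => h x * h x) volume (-1) 1 :=
      (hc.mul hc).intervalIntegrable_of_Icc (by norm_num)
    have hi2 : IntervalIntegrable (fun x => h x * p.eval x) volume (-1) 1 :=
      (hc.mul p.continuous.continuousOn).intervalIntegrable_of_Icc (by norm_num)
    -- Subtracting a Weierstrass approximant `p` is free because `h` is orthogonal to it.
    have e : ∫ x in (-1 : ℝ)..1, h x * h x = ∫ x in (-1 : ℝ)..1, h x * (h x - p.eval x) := by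
      simp_rw [mul_sub]
      rw [intervalIntegral.integral_sub hi hi2, integral_mul_polynomial_eq_zero hc hL, sub_zero]
    have hb : ‖∫ x in (-1 : ℝ)..1, h x * (h x - p.eval x)‖ ≤ C * ε * |(1 : ℝ) - (-1)| := by
      refine intervalIntegral.norm_integral_le_of_norm_le_const (E := ℝ) fun x hx => ?_
      rw [Set.uIoc_of_le (by norm_num)] at hx
      have hx' : x ∈ Set.Icc (-1 : ℝ) 1 := ⟨hx.1.le, hx.2⟩
      rw [norm_mul]
      refine mul_le_mul (hC x hx') ?_ (norm_nonneg _) hC0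
      rw [Real.norm_eq_abs, abs_sub_comm]
      exact (hp x hx').le
    rw [e]
    refine (Real.le_norm_self _).trans (hb.trans (le_of_eq ?_))
    norm_num
  have hle : ∫ x in (-1 : ℝ)..1, h x * h x ≤ 0 := by
    refine le_of_forall_pos_le_add fun ε hε => ?_
    refine (hsq (ε / (2 * (C + 1))) (by positivity)).trans ?_
    rw [zero_add, mul_assoc, div_mul_eq_mul_div, mul_div_assoc', div_le_iff₀ (by positivity)]
    nlinarith
  intro x hx
  by_contra hne
  have := intervalIntegral.integral_pos (by norm_num : (-1 : ℝ) < 1) (hc.mul hc)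
    (fun y _ => mul_self_nonneg (h y)) ⟨x, hx, mul_self_pos.2 hne⟩
  exact absurd hle (not_le.2 this)

/-- The series converges uniformly to a continuous `g`. Termwise integration shows that `g` has the
same Legendre coefficients as `f`, so completeness applied to `f - g` gives `f = g`. -/
theorem tendsto_legendrePartialSum {f : ℝ → ℝ} (hf : ContinuousOn f (Set.Icc (-1) 1))
    (ha : Summable fun n => |legendreCoeff f n|) {x : ℝ} (hx : x ∈ Set.Icc (-1 : ℝ) 1) :
    Filter.Tendsto (fun N => legendrePartialSum f N x) Filter.atTop (nhds (f x)) := by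
  have hbound : ∀ n, ∀ y ∈ Set.Icc (-1 : ℝ) 1,
      ‖legendreCoeff f n * (legendreL n).eval y‖ ≤ |legendreCoeff f n| := by
    intro n y hy
    rw [norm_mul]
    exact mul_le_of_le_one_right (norm_nonneg _) (abs_legendreL_le_one n hy)
  obtain ⟨g, hg⟩ : ∃ g : ℝ → ℝ, g = fun y => ∑' n, legendreCoeff f n * (legendreL n).eval y :=
    ⟨_, rfl⟩
  have hsum : ∀ y ∈ Set.Icc (-1 : ℝ) 1,
      HasSum (fun n => legendreCoeff f n * (legendreL n).eval y) (g y) := by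
    intro y hy
    rw [hg]
    exact (Summable.of_norm_bounded ha (fun n => hbound n y hy)).hasSum
  have hgc : ContinuousOn g (Set.Icc (-1) 1) := by
    rw [hg]
    exact continuousOn_tsum (fun n => by fun_prop) ha hbound
  have hgL : ∀ k, ∫ y in (-1 : ℝ)..1, g y * (legendreL k).eval y =
      ∫ y in (-1 : ℝ)..1, f y * (legendreL k).eval y := by
    intro k
    have h1 : HasSum (fun n => ∫ y in (-1 : ℝ)..1,
        legendreCoeff f n * (legendreL n).eval y * (legendreL k).eval y)
        (∫ y in (-1 : ℝ)..1, g y * (legendreL k).eval y) := by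
      refine intervalIntegral.hasSum_integral_of_dominated_convergence
        (fun n _ => |legendreCoeff f n|) (fun n => ?_) (fun n => ?_) ?_ ?_ ?_
      · exact (Continuous.aestronglyMeasurable (by fun_prop))
      · refine Filter.Eventually.of_forall fun y hy => ?_
        rw [Set.uIoc_of_le (by norm_num)] at hy
        have hy' : y ∈ Set.Icc (-1 : ℝ) 1 := ⟨hy.1.le, hy.2⟩
        rw [norm_mul]
        exact (mul_le_of_le_one_right (norm_nonneg _) (abs_legendreL_le_one k hy')).trans
          (hbound n y hy')
      · exact Filter.Eventually.of_forall fun _ _ => ha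
      · exact intervalIntegrable_const
      · refine Filter.Eventually.of_forall fun y hy => ?_
        rw [Set.uIoc_of_le (by norm_num)] at hy
        exact (hsum y ⟨hy.1.le, hy.2⟩).mul_right _
    have h2 := hasSum_single (f := fun n => ∫ y in (-1 : ℝ)..1,
        legendreCoeff f n * (legendreL n).eval y * (legendreL k).eval y) k (fun n hn => by
      simp_rw [mul_assoc]
      rw [intervalIntegral.integral_const_mul, integral_legendreL_mul_of_ne hn, mul_zero])
    rw [h1.unique h2]
    simp_rw [mul_assoc]
    rw [intervalIntegral.integral_const_mul, legendreCoeff, mul_right_comm,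
      integral_legendreL_mul_self, one_mul]
  have hzero := eq_zero_of_integral_mul_legendreL_eq_zero (hf.sub hgc) (fun k => by
    simp_rw [Pi.sub_apply, sub_mul]
    rw [intervalIntegral.integral_sub, hgL, sub_self]
    · exact (hf.mul (legendreL k).continuous.continuousOn).intervalIntegrable_of_Icc (by norm_num)
    · exact (hgc.mul (legendreL k).continuous.continuousOn).intervalIntegrable_of_Icc (by norm_num))
  have hfg : f x = g x := sub_eq_zero.1 (hzero x hx)
  rw [hfg]
  exact (hsum x hx).tendsto_sum_nat.comp (Filter.tendsto_add_atTop_nat 1)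

/-! ### The error bound -/

theorem sum_abs_legendreCoeff_le {r N : ℕ} (hr : 1 ≤ r) (hN : r + 1 ≤ N) {f : ℝ → ℝ}
    (hac : ∀ k < r, AbsolutelyContinuousOnInterval (derivOnI k f) (-1) 1)
    (hbv : HasBVOnI (derivOnI r f)) (K : ℕ) :
    ∑ i ∈ Finset.range K, |legendreCoeff f (i + (N + 1))| ≤ legendreErr r N * legendreU r f := by
  have hstep : ∀ i ∈ Finset.range K, |legendreCoeff f (i + (N + 1))| ≤
      (legendreErr r ((N + i : ℕ) : ℝ) - legendreErr r ((N + (i + 1) : ℕ) : ℝ)) *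
        legendreU r f := by
    intro i _
    refine (abs_legendreCoeff_le (by omega) hac hbv).trans ?_
    refine mul_le_mul_of_nonneg_right ?_ (legendreU_nonneg r f)
    -- The tail starts at degree `N + 1 ≥ r + 2`, exactly the range of the telescoping estimate.
    have h := sqrt_legendreAntiBound_le (n := i + (N + 1)) hr (by omega)
    have e1 : ((i + (N + 1) : ℕ) : ℝ) - 1 = ((N + i : ℕ) : ℝ) := by push_cast; ring
    have e2 : i + (N + 1) = N + (i + 1) := by omega
    rw [e1] at h
    rwa [e2] at h ⊢
  refine (Finset.sum_le_sum hstep).trans ?_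
  rw [← Finset.sum_mul, Finset.sum_range_sub' (fun i => legendreErr r ((N + i : ℕ) : ℝ)), add_zero]
  have h0 : 0 ≤ legendreErr r ((N + K : ℕ) : ℝ) :=
    legendreErr_nonneg hr (by exact_mod_cast (by omega : r ≤ N + K))
  refine mul_le_mul_of_nonneg_right ?_ (legendreU_nonneg r f)
  linarith

theorem abs_sub_legendrePartialSum_le {r N : ℕ} (hr : 1 ≤ r) (hN : r + 1 ≤ N) {f : ℝ → ℝ}
    (hac : ∀ k < r, AbsolutelyContinuousOnInterval (derivOnI k f) (-1) 1)
    (hbv : HasBVOnI (derivOnI r f)) {x : ℝ} (hx : x ∈ Set.Icc (-1 : ℝ) 1) :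
    |f x - legendrePartialSum f N x| ≤ legendreErr r N * legendreU r f := by
  have hf : ContinuousOn f (Set.Icc (-1) 1) := by
    have := (hac 0 hr).continuousOn
    rwa [derivOnI_zero, Set.uIcc_of_le (by norm_num)] at this
  have hsum := sum_abs_legendreCoeff_le hr hN hac hbv
  have hs : Summable fun n => |legendreCoeff f n| :=
    (summable_nat_add_iff (N + 1)).1
      (summable_of_sum_range_le (fun _ => abs_nonneg _) hsum)
  have hlim := tendsto_legendrePartialSum hf hs hx
  have hlim' := ((hlim.comp (Filter.tendsto_add_atTop_nat N)).sub_const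
    (legendrePartialSum f N x)).abs
  -- The bound for finite blocks of the tail is uniform in `K`, hence survives the limit.
  refine le_of_tendsto' hlim' fun K => ?_
  have e : legendrePartialSum f (K + N) x - legendrePartialSum f N x =
      ∑ i ∈ Finset.range K,
        legendreCoeff f (i + (N + 1)) * (legendreL (i + (N + 1))).eval x := by
    rw [legendrePartialSum, legendrePartialSum, show K + N + 1 = N + 1 + K by omega,
      Finset.sum_range_add, add_sub_cancel_left]
    exact Finset.sum_congr rfl fun i _ => by rw [add_comm]
  simp only [Function.comp]
  rw [e]
  refine (Finset.abs_sum_le_sum_abs _ _).trans ((Finset.sum_le_sum fun i _ => ?_).trans (hsum K))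
  rw [abs_mul]
  exact mul_le_of_le_one_right (abs_nonneg _) (abs_legendreL_le_one _ hx)

theorem theorem2p2 (r N : ℕ) (hr : 1 ≤ r) (hN : r + 1 ≤ N) (f : ℝ → ℝ)
    (hac : ∀ k < r, AbsolutelyContinuousOnInterval (derivOnI k f) (-1) 1)
    (hbv : HasBVOnI (derivOnI r f)) :
    (r = 1 → ∀ x ∈ Set.Icc (-1 : ℝ) 1,
      |f x - legendrePartialSum f N x| ≤
        2 * legendreA * legendreU 1 f / Real.sqrt ((N : ℝ) - 2 / 3)) ∧
    (2 ≤ r → Odd r → ∀ x ∈ Set.Icc (-1 : ℝ) 1,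
      |f x - legendrePartialSum f N x| ≤
        legendreA * ((N : ℝ) + 3 / 2) * legendreU r f /
          ((∏ j ∈ Finset.Icc 1 r, ((N : ℝ) - r + 2 * j - 3 / 2)) * ((r : ℝ) - 1 / 2) *
            Real.sqrt ((N : ℝ) - r + 1 / 3))) ∧
    (2 ≤ r → Even r → ∀ x ∈ Set.Icc (-1 : ℝ) 1,
      |f x - legendrePartialSum f N x| ≤
        legendreA * ((N : ℝ) + 1 / 2) * legendreU r f /
          ((∏ j ∈ Finset.Icc 1 r, ((N : ℝ) - r + 2 * j - 3 / 2)) * ((r : ℝ) - 1 / 2) *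
            Real.sqrt ((N : ℝ) - r + 1 / 3))) := by
  refine ⟨fun h1 x hx => ?_, fun h2 ho x hx => ?_, fun h2 he x hx => ?_⟩ <;>
    have h := abs_sub_legendrePartialSum_le hr hN hac hbv hx
  · subst h1
    rwa [legendreErr, if_pos rfl, div_mul_eq_mul_div] at h
  · rwa [legendreErr, if_neg (by omega), legendreShift, if_neg (Nat.not_even_iff_odd.2 ho),
      div_mul_eq_mul_div, legendreProd] at h
  · rwa [legendreErr, if_neg (by omega), legendreShift, if_pos he, div_mul_eq_mul_div,
      legendreProd] at h
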